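/- Let $\mu$ be a measure on a measurable space $(\Omega,\mathcal F)$ and let $\mathcal M_\mu$ be the set of probability measures on $(\Omega,\mathcal F)$ that have a density with respect to $\mu$; the density of $P$, $Q$, … is written $p$, $q$, …. Let $q',q''$ be measurable functions on $\Omega$ with values in $[0,\infty]$ such that $$0\le q'\le q'',\qquad \int q'\,\mathrm d\mu\le 1,\qquad \int q''\,\mathrm d\mu\ge 1,$$ and let $\mathcal Q^{=}=\{Q\in\mathcal M_\mu : q'\le q\le q''\ \ \mu\text{-a.e.}\}$ be the corresponding band class. For a convex function $f$ on $[0,\infty)$ with $f(1)=0$, real-valued on $(0,\infty)$ and with $f(0)\in(-\infty,\infty]$, and for $P_0,P_1\in\mathcal M_\mu$, the $f$-divergence is $$D_f(P_0\|P_1)=\int_{\{p_1>0\}} f\!\left(\frac{p_0}{p_1}\right)\mathrm dP_1+f'(\infty)\,P_0[p_1=0]\in(-\infty,\infty],\qquad f'(\infty)=\lim_{s\to\infty}\frac{f(s)}{s},$$ with the convention $0\cdot\infty=0$. Let $P\in\mathcal M_\mu$ have density $p$, and suppose that for some $c\in[0,\infty)$ there is a probability measure $Q^*$ with density $$q^*=\min\{q'',\max\{c\,p,\,q'\}\}$$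 with respect to $\mu$. Then: 1. $Q^*$ is unique: if, for some $c'\in[0,\infty)$, $Q$ is a probability measure with density $\min\{q'',\max\{c'p,q'\}\}$, then $Q=Q^*$. 2. $Q^*\in\mathcal Q^{=}$, and for every such convex function $f$ and every $Q\in\mathcal Q^{=}$, $$D_f(P\|Q^*)\le D_f(P\|Q)\qquad\text{and}\qquad D_f(Q^*\|P)\le D_f(Q\|P).$$ 3. $Q^*$ is the unique such minimizer: if $Q\in\mathcal Q^{=}$ minimizes $D_f(P\|\cdot)$ over $\mathcal Q^{=}$ for every such $f$, or minimizes $D_f(\cdot\|P)$ over $\mathcal Q^{=}$ for every such $f$, then $Q=Q^*$. -/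

import Mathlib

open MeasureTheory Filter
open scoped ENNReal NNReal

namespace BandModel

variable {Ω : Type*} [MeasurableSpace Ω]

/-- `P` is a probability distribution with density `p` with respect to `μ`. -/
structure HasDensity (μ P : Measure Ω) (p : Ω → ℝ≥0∞) : Prop where
  isProbabilityMeasure : IsProbabilityMeasure P
  measurable : Measurable p
  eq_withDensity : P = μ.withDensity p

/-- Admissible lower and upper bounds `qL ≤ qU` of a density band: the lower bound has mass at
most one, the upper bound has mass at least one (its mass, and its values, may be infinite). -/
structure IsBand (μ : Measure Ω) (qL qU : Ω → ℝ≥0∞) : Prop where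
  measurable_lower : Measurable qL
  measurable_upper : Measurable qU
  le : ∀ x, qL x ≤ qU x
  lower_mass : ∫⁻ x, qL x ∂μ ≤ 1
  upper_mass : 1 ≤ ∫⁻ x, qU x ∂μ

/-- The band class: all probability distributions having a density `q` with respect to `μ` such
that `qL ≤ q ≤ qU`. -/
def band (μ : Measure Ω) (qL qU : Ω → ℝ≥0∞) : Set (Measure Ω) :=
  {Q | ∃ q, HasDensity μ Q q ∧ ∀ᵐ x ∂μ, qL x ≤ q x ∧ q x ≤ qU x}

/-- The function `min {qU, max {c * p, qL}}`. -/
noncomputable def clip (qL qU p : Ω → ℝ≥0∞) (c : ℝ≥0) : Ω → ℝ≥0∞ :=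
  fun x => min (qU x) (max ((c : ℝ≥0∞) * p x) (qL x))

/-- Generators of `f`-divergences: convex functions `f` on `[0, ∞)` with `f 1 = 0` that are
real-valued on `(0, ∞)`; the value at `0` may be `+∞` (as for `f s = - log s`). -/
structure IsGenerator (f : ℝ≥0 → EReal) : Prop where
  ne_bot : ∀ s, f s ≠ ⊥
  ne_top : ∀ s, 0 < s → f s ≠ ⊤
  convex : ∀ s t a b : ℝ≥0, a + b = 1 →
    f (a * s + b * t) ≤ ((a : ℝ) : EReal) * f s + ((b : ℝ) : EReal) * f t
  map_one : f 1 = 0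

/-- Integral of an extended real-valued function: integral of the positive part minus integral of
the negative part. (In the divergence below the latter is finite, so `∞ - ∞` does not occur.) -/
noncomputable def eintegral (ν : Measure Ω) (g : Ω → EReal) : EReal :=
  ((∫⁻ x, (g x).toENNReal ∂ν : ℝ≥0∞) : EReal) - ((∫⁻ x, (- g x).toENNReal ∂ν : ℝ≥0∞) : EReal)

/-- `f'(∞) = lim_{s → ∞} f s / s`, an extended real number. (The limit exists for convex `f`; it is
written as an upper limit, which is always defined.) -/
noncomputable def slopeAtTop (f : ℝ≥0 → EReal) : EReal :=
  limsup (fun s : ℝ≥0 => f s / ((s : ℝ) : EReal)) atTop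

/-- The `f`-divergence `D_f(P‖Q) = ∫_{q > 0} f (p / q) dQ + f'(∞) P[q = 0]` of two distributions
with densities `p`, `q` with respect to `μ`; the convention is `0 * ∞ = 0`. -/
noncomputable def fDiv (μ : Measure Ω) (f : ℝ≥0 → EReal) (P Q : Measure Ω) : EReal :=
  eintegral (Q.restrict {x | 0 < Q.rnDeriv μ x})
      (fun x => f (P.rnDeriv μ x / Q.rnDeriv μ x).toNNReal)
    + slopeAtTop f * ((P {x | Q.rnDeriv μ x = 0} : ℝ≥0∞) : EReal)

end BandModel

/-! Pointwise, the clipped density lies between `c * p` and the density `q` of any competitor in the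
band, so it suffices to see that the integrand of the divergence grows as `q` moves away from `c *
p` in either direction.

This is arranged by subtracting a supporting line. Replacing `f s` by `f s - (a * s + b)` changes
the divergence of two probability measures only by the constant `a + b`. With the line touching `f`
at `s₀ = c⁻¹` for `D_f(P‖·)`, and at `s₀ = c` for `D_f(·‖P)`, what remains is a convex `g ≥ 0` with
`g s₀ = 0`. The divergence becomes the integral of the perspective `v * g (u / v)` plus a constant
(`fDiv_eq_lintegral_persp`). The perspective vanishes on the ray of slope `s₀` and is monotone on
either side (`IsValley.persp_mono_right`, `IsValley.persp_mono_left`), so minimality holds already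
for the integrands.

For uniqueness of the minimizer, generators `|s - s₀|`, up to a constant, suffice: they turn the
divergence into a positive multiple of `∫ |c * p - q| dμ` plus a constant, and equality of these
integrals forces equality of the densities a.e. For `c = 0` there may be no supporting line at `s₀`,
but then the lower bound is itself a probability density and the band is a single point. -/

namespace BandModel

/-! ### Convex generators: supporting lines and slopes at infinity -/

/-- A splitting of `f` into a nonnegative part `g`, of slope `m` at infinity, and an affine
function. -/
structure IsSplitting (f : ℝ≥0 → EReal) (g : ℝ≥0 → ℝ≥0∞) (m : ℝ≥0∞) (a b : ℝ) : Prop where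
  measurable : Measurable g
  eq_add : ∀ s, f s = (g s : EReal) + ((a * s + b : ℝ) : EReal)
  slope_eq : slopeAtTop f = (m : EReal) + (a : EReal)

/-- `g` decreases to zero at `s₀`, increases afterwards with `g s / s` increasing, and `m` bounds
`g s / s` there. -/
structure IsValley (g : ℝ≥0 → ℝ≥0∞) (m : ℝ≥0∞) (s₀ : ℝ≥0) : Prop where
  anti : ∀ s t, s ≤ t → t ≤ s₀ → g t ≤ g s
  ratio : ∀ s t, s₀ ≤ s → s ≤ t → g s * t ≤ g t * s
  slope : ∀ s, s₀ ≤ s → g s ≤ m * s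

theorem IsValley.mono {g : ℝ≥0 → ℝ≥0∞} {m : ℝ≥0∞} {s₀ : ℝ≥0} (h : IsValley g m s₀)
    (hs₀ : 0 < s₀) {s t : ℝ≥0} (hs : s₀ ≤ s) (hst : s ≤ t) : g s ≤ g t := by
  have h1 := h.ratio s t hs hst
  have hs' : (s : ℝ≥0∞) ≠ 0 := by
    simpa using (hs₀.trans_le hs).ne'
  have h2 : g s * s ≤ g t * s := le_trans (by gcongr) h1
  exact (ENNReal.mul_le_mul_iff_left hs' ENNReal.coe_ne_top).1 h2

/-- A convex function has an affine minorant touching it at a positive point. -/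
theorem IsGenerator.exists_affine_minorant {f : ℝ≥0 → EReal} (hf : IsGenerator f) {s₀ : ℝ≥0}
    (hs₀ : 0 < s₀) : ∃ a b : ℝ, f s₀ = ((a * s₀ + b : ℝ) : EReal) ∧
      ∀ s : ℝ≥0, ((a * s + b : ℝ) : EReal) ≤ f s := by
  set F : ℝ → ℝ := fun x => (f x.toNNReal).toReal with hF
  have hfF : ∀ s : ℝ≥0, 0 < s → f s = (F s : EReal) := by
    intro s hs
    simp [hF, EReal.coe_toReal (hf.ne_top s hs) (hf.ne_bot s)]
  have hconv : ConvexOn ℝ (Set.Ioi 0) F := by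
    refine ⟨convex_Ioi 0, ?_⟩
    intro x hx y hy α β hα hβ hαβ
    lift x to ℝ≥0 using le_of_lt hx
    lift y to ℝ≥0 using le_of_lt hy
    lift α to ℝ≥0 using hα
    lift β to ℝ≥0 using hβ
    have hx' : 0 < x := by simpa using hx
    have hy' : 0 < y := by simpa using hy
    have hab : α + β = 1 := by exact_mod_cast hαβ
    have hpos : 0 < α * x + β * y := by
      have : (0 : ℝ) < α * x + β * y := (convex_Ioi (0 : ℝ)) hx hy α.2 β.2 hαβ
      exact_mod_cast this
    have h := hf.convex x y α β hab
    rw [hfF _ hpos, hfF x hx', hfF y hy'] at h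
    simp only [smul_eq_mul]
    exact_mod_cast h
  have hint : (s₀ : ℝ) ∈ interior (Set.Ioi (0 : ℝ)) := by
    rw [interior_Ioi]; exact_mod_cast hs₀
  set a := derivWithin F (Set.Ioi (s₀ : ℝ)) s₀ with ha
  have key : ∀ y : ℝ, 0 < y → F s₀ + a * (y - s₀) ≤ F y := by
    intro y hy
    rcases lt_trichotomy y s₀ with hlt | heq | hgt
    · have h1 := hconv.slope_le_leftDeriv_of_mem_interior hy hint hlt
      have h2 := hconv.leftDeriv_le_rightDeriv_of_mem_interior hint
      have h3 := h1.trans h2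
      rw [slope_def_field, div_le_iff₀ (sub_pos.2 hlt)] at h3
      linarith
    · simp [heq]
    · have h1 := hconv.rightDeriv_le_slope_of_mem_interior hint hy hgt
      rw [slope_def_field, le_div_iff₀ (sub_pos.2 hgt)] at h1
      linarith
  refine ⟨a, F s₀ - a * s₀, ?_, ?_⟩
  · rw [hfF s₀ hs₀]; congr 1; ring
  · intro s
    rcases eq_or_lt_of_le (show 0 ≤ s from zero_le) with rfl | hs
    · by_cases htop : f 0 = ⊤
      · simp [htop]
      · have h0 : f 0 = ((f 0).toReal : EReal) := (EReal.coe_toReal htop (hf.ne_bot 0)).symm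
        -- The derivative argument covers only the open half-line. At `0` the bound follows from
        -- convexity at the midpoint of `0` and `s₀`, combined with `key` at that midpoint.
        have h := hf.convex 0 s₀ 2⁻¹ 2⁻¹ (by rw [← two_mul]; simp)
        have hp : 0 < (2⁻¹ * 0 + 2⁻¹ * s₀ : ℝ≥0) := by simpa using hs₀
        rw [hfF _ hp, h0, hfF s₀ hs₀] at h
        have h' : F ((2⁻¹ * 0 + 2⁻¹ * s₀ : ℝ≥0) : ℝ)
            ≤ ((2⁻¹ : ℝ≥0) : ℝ) * (f 0).toReal + ((2⁻¹ : ℝ≥0) : ℝ) * F s₀ := by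
          exact_mod_cast h
        have h3 := key _ (show (0 : ℝ) < ((2⁻¹ * 0 + 2⁻¹ * s₀ : ℝ≥0) : ℝ) by exact_mod_cast hp)
        rw [h0, EReal.coe_le_coe_iff]
        push_cast at h' h3 ⊢
        linarith
    · rw [hfF s hs, EReal.coe_le_coe_iff]
      have := key s (by exact_mod_cast hs)
      linarith

/-- A nonnegative function on `[0, ∞)` that is convex and vanishes at `s₀ > 0` has a slope at
infinity. -/
theorem exists_isValley_of_convex {g : ℝ≥0 → ℝ≥0∞} {s₀ : ℝ≥0} (hs₀ : 0 < s₀)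
    (hg : ∀ t α β : ℝ≥0, α + β = 1 → g (α * s₀ + β * t) ≤ β * g t) :
    ∃ m, IsValley g m s₀ ∧ Tendsto (fun s : ℝ≥0 => g s / s) atTop (nhds m) := by
  have hratio : ∀ s t, s₀ ≤ s → s ≤ t → g s * t ≤ g t * s := by
    intro s t hs hst
    rcases eq_or_lt_of_le (hs.trans hst) with heq | hlt
    · have : s = t := le_antisymm hst (heq ▸ hs)
      rw [this]
    · have hts : 0 < t - s₀ := tsub_pos_of_lt hlt
      have hr : (0 : ℝ) < t - s₀ := sub_pos.2 (by exact_mod_cast hlt)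
      -- The weights that write `s` as a convex combination of `s₀` and `t`.
      have h := hg t ((t - s) / (t - s₀)) ((s - s₀) / (t - s₀)) (by
        rw [← add_div, tsub_add_tsub_cancel hst hs, div_self hts.ne'])
      have he : (t - s) / (t - s₀) * s₀ + (s - s₀) / (t - s₀) * t = s := by
        apply NNReal.eq
        push_cast [NNReal.coe_sub hst, NNReal.coe_sub hs, NNReal.coe_sub hlt.le]
        field_simp
        ring
      rw [he] at h
      have hb : (s - s₀) / (t - s₀) * t ≤ s := by
        rw [← NNReal.coe_le_coe]
        push_cast [NNReal.coe_sub hst, NNReal.coe_sub hs, NNReal.coe_sub hlt.le]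
        rw [div_mul_eq_mul_div, div_le_iff₀ hr]
        have h1 : (s : ℝ) ≤ t := by exact_mod_cast hst
        nlinarith [s₀.2]
      calc g s * t ≤ (((s - s₀) / (t - s₀) : ℝ≥0) * g t) * t := by gcongr
        _ = g t * (((s - s₀) / (t - s₀) * t : ℝ≥0) : ℝ≥0∞) := by push_cast; ring
        _ ≤ g t * s := by gcongr
  have hdiv : ∀ s t, s₀ ≤ s → s ≤ t → g s / s ≤ g t / t := by
    intro s t hs hst
    have h0 : (s : ℝ≥0∞) ≠ 0 := by simpa using (hs₀.trans_le hs).ne'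
    have h0' : (t : ℝ≥0∞) ≠ 0 := by simpa using (hs₀.trans_le (hs.trans hst)).ne'
    rw [ENNReal.div_le_iff h0 ENNReal.coe_ne_top, div_eq_mul_inv, mul_right_comm,
      ← div_eq_mul_inv, ENNReal.le_div_iff_mul_le (.inl h0') (.inl ENNReal.coe_ne_top)]
    exact hratio s t hs hst
  -- Truncating at `s₀` makes the quotient monotone on the whole half-line, so its supremum is its
  -- limit.
  have hmono : Monotone fun s : ℝ≥0 => g (max s s₀) / (max s s₀ : ℝ≥0) := fun s t hst =>
    hdiv _ _ (le_max_right _ _) (max_le_max_right _ hst)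
  refine ⟨⨆ s : ℝ≥0, g (max s s₀) / (max s s₀ : ℝ≥0), ⟨?_, hratio, ?_⟩, ?_⟩
  · intro s t hst ht
    rcases eq_or_lt_of_le (hst.trans ht) with heq | hlt
    · have : s = t := le_antisymm hst (heq ▸ ht)
      rw [this]
    · have hts : 0 < s₀ - s := tsub_pos_of_lt hlt
      have hr : (0 : ℝ) < s₀ - s := sub_pos.2 (by exact_mod_cast hlt)
      have h := hg s ((t - s) / (s₀ - s)) ((s₀ - t) / (s₀ - s)) (by
        rw [← add_div, add_comm, tsub_add_tsub_cancel ht hst, div_self hts.ne'])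
      have he : (t - s) / (s₀ - s) * s₀ + (s₀ - t) / (s₀ - s) * s = t := by
        apply NNReal.eq
        push_cast [NNReal.coe_sub hst, NNReal.coe_sub ht, NNReal.coe_sub hlt.le]
        field_simp
        ring
      rw [he] at h
      refine h.trans ?_
      have hb : (s₀ - t) / (s₀ - s) ≤ 1 := by
        rw [div_le_one hts]
        exact tsub_le_tsub_left hst _
      calc (((s₀ - t) / (s₀ - s) : ℝ≥0) : ℝ≥0∞) * g s ≤ 1 * g s := by
            gcongr; exact_mod_cast hb
        _ = g s := one_mul _
  · intro s hs
    have h0 : (s : ℝ≥0∞) ≠ 0 := by simpa using (hs₀.trans_le hs).ne'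
    rw [← ENNReal.div_le_iff h0 ENNReal.coe_ne_top]
    have := le_iSup (fun s : ℝ≥0 => g (max s s₀) / (max s s₀ : ℝ≥0)) s
    simpa [max_eq_left hs] using this
  · refine (tendsto_atTop_iSup hmono).congr' ?_
    filter_upwards [eventually_ge_atTop s₀] with s hs
    rw [max_eq_left hs]

/-- Sublevel sets are intervals, because `g` decreases up to `s₀` and increases afterwards. -/
theorem IsValley.measurable {g : ℝ≥0 → ℝ≥0∞} {m : ℝ≥0∞} {s₀ : ℝ≥0} (h : IsValley g m s₀)
    (hs₀ : 0 < s₀) : Measurable g := by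
  refine measurable_of_Iic fun x => Set.OrdConnected.measurableSet ⟨?_⟩
  intro y hy z hz w hw
  rcases le_total w s₀ with hws | hws
  · exact (h.anti y w hw.1 hws).trans hy
  · exact (h.mono hs₀ hws hw.2).trans hz

/-- The slope at infinity of a sum of a nonnegative and an affine function. -/
theorem slopeAtTop_eq_add {f : ℝ≥0 → EReal} {g : ℝ≥0 → ℝ≥0∞} {m : ℝ≥0∞} {a b : ℝ}
    (h : ∀ s, f s = (g s : EReal) + ((a * s + b : ℝ) : EReal))
    (hm : Tendsto (fun s : ℝ≥0 => g s / s) atTop (nhds m)) :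
    slopeAtTop f = (m : EReal) + (a : EReal) := by
  apply Tendsto.limsup_eq
  have h1 : Tendsto (fun s : ℝ≥0 => ((g s / s : ℝ≥0∞) : EReal)) atTop (nhds (m : EReal)) :=
    (continuous_coe_ennreal_ereal.tendsto m).comp hm
  have h2 : Tendsto (fun s : ℝ≥0 => ((a + b / s : ℝ) : EReal)) atTop (nhds (a : EReal)) := by
    refine (continuous_coe_real_ereal.tendsto a).comp ?_
    have : Tendsto (fun s : ℝ≥0 => (s : ℝ)) atTop atTop := NNReal.tendsto_coe_atTop.2 tendsto_id
    simpa using (tendsto_const_nhds (x := a)).add (this.const_div_atTop b)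
  have h3 := (EReal.continuousAt_add (p := ((m : EReal), (a : EReal))) (by simp) (by simp)).tendsto.comp
    (h1.prodMk_nhds h2)
  refine h3.congr' ?_
  filter_upwards [eventually_gt_atTop 0] with s hs
  have hs' : (0 : ℝ) < s := by exact_mod_cast hs
  rw [h s, Function.comp_apply]
  have e1 : ((g s / s : ℝ≥0∞) : EReal) = (g s : EReal) / ((s : ℝ) : EReal) := by
    induction hgs : g s with
    | top =>
      rw [ENNReal.top_div_of_ne_top ENNReal.coe_ne_top, EReal.coe_ennreal_top,
        EReal.top_div_of_pos_ne_top (by exact_mod_cast hs') (EReal.coe_ne_top _)]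
    | coe y =>
      rw [← ENNReal.coe_div hs.ne']
      change (((y / s : ℝ≥0) : ℝ) : EReal) = ((y : ℝ) : EReal) / ((s : ℝ) : EReal)
      rw [← EReal.coe_div]; simp
  have e2 : ((a + b / s : ℝ) : EReal) = ((a * s + b : ℝ) : EReal) / ((s : ℝ) : EReal) := by
    rw [← EReal.coe_div]; congr 1; field_simp
  simp only [e1, e2]
  rw [EReal.div_eq_inv_mul, EReal.div_eq_inv_mul, EReal.div_eq_inv_mul, ← EReal.coe_inv,
    EReal.left_distrib_of_nonneg_of_ne_top (by exact_mod_cast (inv_pos.2 hs').le)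
      (EReal.coe_ne_top _)]

/-- A generator splits at any positive point into a valley and an affine function. -/
theorem IsGenerator.exists_isSplitting {f : ℝ≥0 → EReal} (hf : IsGenerator f) {s₀ : ℝ≥0}
    (hs₀ : 0 < s₀) : ∃ g m a b, IsSplitting f g m a b ∧ IsValley g m s₀ := by
  obtain ⟨a, b, h0, hle⟩ := hf.exists_affine_minorant hs₀
  set g : ℝ≥0 → ℝ≥0∞ := fun s => (f s - ((a * s + b : ℝ) : EReal)).toENNReal with hg
  have heq : ∀ s, f s = (g s : EReal) + ((a * s + b : ℝ) : EReal) := by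
    intro s
    rw [hg]
    dsimp only
    rw [EReal.coe_toENNReal, EReal.sub_add_cancel]
    rw [EReal.sub_nonneg (.inr (EReal.coe_ne_top _)) (.inr (EReal.coe_ne_bot _))]
    exact hle s
  have hconv : ∀ t α β : ℝ≥0, α + β = 1 → g (α * s₀ + β * t) ≤ β * g t := by
    intro t α β hαβ
    have h := hf.convex s₀ t α β hαβ
    rw [h0, heq t, heq, EReal.left_distrib_of_nonneg_of_ne_top
      (by exact_mod_cast β.2) (EReal.coe_ne_top _), ← EReal.coe_mul, ← EReal.coe_mul,
      add_left_comm, ← EReal.coe_add] at h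
    have e : (α : ℝ) * (a * s₀ + b) + β * (a * t + b) = a * ((α * s₀ + β * t : ℝ≥0) : ℝ) + b := by
      have : (α : ℝ) = 1 - β := by rw [eq_sub_iff_add_eq]; exact_mod_cast hαβ
      push_cast; rw [this]; ring
    rw [e] at h
    -- The affine parts of the two sides agree and are finite, so they cancel.
    have h' := (EReal.addLECancellable_coe _).add_le_add_iff_right.1 h
    have : ((β : ℝ) : EReal) = ((β : ℝ≥0∞) : EReal) := rfl
    rw [this, ← EReal.coe_ennreal_mul, EReal.coe_ennreal_le_coe_ennreal_iff] at h'
    exact h'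
  obtain ⟨m, hv, hm⟩ := exists_isValley_of_convex hs₀ hconv
  exact ⟨g, m, a, b, ⟨hv.measurable hs₀, heq, slopeAtTop_eq_add heq hm⟩, hv⟩

/-! ### Pointwise comparison: clipping and perspectives -/

/-- The clipped density lies between `c * p` and any density of the band. -/
theorem clip_between {Ω : Type*} {qL qU p : Ω → ℝ≥0∞} {c : ℝ≥0} {x : Ω} {y : ℝ≥0∞} (hL : qL x ≤ y)
    (hU : y ≤ qU x) :
    (c * p x ≤ clip qL qU p c x ∧ clip qL qU p c x ≤ y) ∨
      (y ≤ clip qL qU p c x ∧ clip qL qU p c x ≤ c * p x) := by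
  unfold clip
  rcases le_total (c * p x) (qL x) with h | h
  · rw [max_eq_right h, min_eq_right (hL.trans hU)]
    exact .inl ⟨h, hL⟩
  · rw [max_eq_left h]
    rcases le_total (qU x) (c * p x) with h' | h'
    · rw [min_eq_left h']
      exact .inr ⟨hU, h'⟩
    · rw [min_eq_right h']
      exact (le_total _ _).imp (fun h => ⟨le_rfl, h⟩) fun h => ⟨h, le_rfl⟩

variable {Ω : Type*} [MeasurableSpace Ω]

/-- The perspective of a nonnegative function `g` of slope `m` at infinity. -/
noncomputable def persp (g : ℝ≥0 → ℝ≥0∞) (m u v : ℝ≥0∞) : ℝ≥0∞ :=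
  if v = 0 then m * u else v * g (u / v).toNNReal

/-- For `v ≥ c * u` the quotient `u / v` lies where `g` decreases, so both factors of `v * g (u /
v)` grow with `v`. For `0 < v ≤ c * u` and `s = u / v`, the perspective is `u * (g s / s)`, which
grows as `v` decreases; its bound `m * u` is the value at `v = 0`. -/
theorem IsValley.persp_mono_right {g : ℝ≥0 → ℝ≥0∞} {m : ℝ≥0∞} {c : ℝ≥0}
    (h : IsValley g m c⁻¹) (hc : 0 < c) {u v w : ℝ≥0}
    (huvw : (c * u ≤ v ∧ v ≤ w) ∨ (w ≤ v ∧ v ≤ c * u)) :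
    persp g m u v ≤ persp g m u w := by
  have hs₀ : 0 < c⁻¹ := inv_pos.2 hc
  have hdiv : ∀ x y : ℝ≥0, y ≠ 0 → ((x : ℝ≥0∞) / y).toNNReal = x / y := fun x y hy => by
    rw [← ENNReal.coe_div hy, ENNReal.toNNReal_coe]
  have hle : ∀ x : ℝ≥0, 0 < x → x ≤ c * u → c⁻¹ ≤ u / x := fun x hx hxu => by
    rw [le_div_iff₀ hx, inv_mul_le_iff₀ hc]; exact hxu
  have hge : ∀ x : ℝ≥0, 0 < x → c * u ≤ x → u / x ≤ c⁻¹ := fun x hx hxu => by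
    rw [div_le_iff₀ hx, le_inv_mul_iff₀ hc]; exact hxu
  have hnear : ∀ x : ℝ≥0, 0 < x → (x : ℝ≥0∞) * (u / x : ℝ≥0) = u := fun x hx => by
    rw [← ENNReal.coe_mul, mul_div_cancel₀ _ hx.ne']
  unfold persp
  rcases huvw with ⟨h1, h2⟩ | ⟨h1, h2⟩
  · rcases eq_or_ne v 0 with rfl | hv
    · have hu : u = 0 := by
        rcases mul_eq_zero.1 (le_antisymm h1 zero_le) with h | h
        · exact absurd h hc.ne'
        · exact h
      simp [hu]
    · have hv' : 0 < v := pos_iff_ne_zero.2 hv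
      have hw' : 0 < w := hv'.trans_le h2
      rw [if_neg (by simpa using hv), if_neg (by simpa using hw'.ne'), hdiv _ _ hv,
        hdiv _ _ hw'.ne']
      gcongr
      exact h.anti _ _ (by gcongr) (hge v hv' h1)
  · rcases eq_or_ne w 0 with rfl | hw
    · rcases eq_or_ne v 0 with rfl | hv
      · rfl
      · have hv' : 0 < v := pos_iff_ne_zero.2 hv
        rw [if_neg (by simpa using hv), if_pos (by simp), hdiv _ _ hv]
        calc (v : ℝ≥0∞) * g (u / v) ≤ v * (m * (u / v : ℝ≥0)) := by
              gcongr; exact h.slope _ (hle v hv' h2)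
          _ = m * (v * (u / v : ℝ≥0)) := by ring
          _ = m * u := by rw [hnear v hv']
    · have hw' : 0 < w := pos_iff_ne_zero.2 hw
      have hv' : 0 < v := hw'.trans_le h1
      rw [if_neg (by simpa using hv'.ne'), if_neg (by simpa using hw), hdiv _ _ hv'.ne',
        hdiv _ _ hw]
      have hr := h.ratio (u / v) (u / w) (hle v hv' h2) (by gcongr)
      have hu : (u : ℝ≥0∞) ≠ 0 := by
        rintro hu
        have hu' : u = 0 := by exact_mod_cast hu
        simp [hu'] at h2
        exact hv'.ne' h2
      -- Multiplying by `u = w * (u / w) = v * (u / v)` turns the claim into the monotonicity of `g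
      -- s / s` in its division-free form.
      refine (ENNReal.mul_le_mul_iff_left hu ENNReal.coe_ne_top).1 ?_
      calc (v : ℝ≥0∞) * g (u / v) * u = v * g (u / v) * (w * (u / w : ℝ≥0)) := by
            rw [hnear w hw']
        _ = v * w * (g (u / v) * (u / w : ℝ≥0)) := by ring
        _ ≤ v * w * (g (u / w) * (u / v : ℝ≥0)) := by gcongr
        _ = w * g (u / w) * (v * (u / v : ℝ≥0)) := by ring
        _ = w * g (u / w) * u := by rw [hnear v hv']

/-- Here the second argument `u` is fixed, so only the monotonicity of `g` on the two sides of `c`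
matters; at `u = 0` the perspective is linear in the first argument. -/
theorem IsValley.persp_mono_left {g : ℝ≥0 → ℝ≥0∞} {m : ℝ≥0∞} {c : ℝ≥0}
    (h : IsValley g m c) (hc : 0 < c) {u v w : ℝ≥0}
    (huvw : (c * u ≤ v ∧ v ≤ w) ∨ (w ≤ v ∧ v ≤ c * u)) :
    persp g m v u ≤ persp g m w u := by
  unfold persp
  rcases eq_or_ne u 0 with rfl | hu
  · rw [if_pos (by simp), if_pos (by simp)]
    rcases huvw with ⟨-, h2⟩ | ⟨-, h2⟩
    · gcongr
    · have : v = 0 := by simpa using h2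
      simp [this]
  · have hu' : 0 < u := pos_iff_ne_zero.2 hu
    rw [if_neg (by simpa using hu), if_neg (by simpa using hu), ← ENNReal.coe_div hu,
      ← ENNReal.coe_div hu, ENNReal.toNNReal_coe, ENNReal.toNNReal_coe]
    gcongr
    rcases huvw with ⟨h1, h2⟩ | ⟨h1, h2⟩
    · exact h.mono hc ((le_div_iff₀ hu').2 h1) (by gcongr)
    · exact h.anti _ _ (by gcongr) ((div_le_iff₀ hu').2 h2)

/-! ### Divergences as integrals of perspectives -/

theorem eintegral_add_real {ν : Measure Ω} {G : Ω → ℝ≥0∞} {r : Ω → ℝ} (hG : Measurable G)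
    (hr : Measurable r) (hint : Integrable r ν) :
    eintegral ν (fun x => (G x : EReal) + (r x : EReal))
      = ((∫⁻ x, G x ∂ν : ℝ≥0∞) : EReal) + ((∫ x, r x ∂ν : ℝ) : EReal) := by
  set F : Ω → EReal := fun x => (G x : EReal) + (r x : EReal) with hF
  have hneg : ∀ x, (-F x).toENNReal ≤ ENNReal.ofReal (-r x) := by
    intro x
    rw [← EReal.real_coe_toENNReal]
    apply EReal.toENNReal_le_toENNReal
    rw [EReal.coe_neg, EReal.neg_le_neg_iff]
    exact le_add_of_nonneg_left (EReal.coe_ennreal_nonneg _)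
  -- The identity `F = G + r` in positive and negative parts, rearranged without subtraction: it
  -- holds also where `G = ∞`, and it can be integrated term by term.
  have key : ∀ x, (F x).toENNReal + ENNReal.ofReal (-r x)
      = ((-F x).toENNReal + ENNReal.ofReal (r x)) + G x := by
    intro x
    simp only [hF]
    induction G x with
    | top => simp
    | coe y =>
      have e : ((y : ℝ≥0∞) : EReal) + (r x : EReal) = ((y + r x : ℝ) : EReal) := rfl
      rw [e, ← EReal.coe_neg, EReal.real_coe_toENNReal, EReal.real_coe_toENNReal,
        ← ENNReal.ofReal_coe_nnreal]
      have hy : (0 : ℝ) ≤ y := y.2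
      rcases le_total 0 (r x) with h | h <;> rcases le_total 0 (y + r x) with h' | h'
      · rw [ENNReal.ofReal_of_nonpos (p := -r x) (by linarith),
          ENNReal.ofReal_of_nonpos (p := -(y + r x)) (by linarith), zero_add, add_zero,
          ← ENNReal.ofReal_add h hy, add_comm]
      · have h1 : (y : ℝ) = 0 := by linarith
        have h2 : r x = 0 := by linarith
        simp [h1, h2]
      · rw [ENNReal.ofReal_of_nonpos (p := r x) h,
          ENNReal.ofReal_of_nonpos (p := -(y + r x)) (by linarith), zero_add, zero_add,
          ← ENNReal.ofReal_add h' (by linarith)]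
        congr 1; ring
      · rw [ENNReal.ofReal_of_nonpos (p := r x) h,
          ENNReal.ofReal_of_nonpos (p := y + r x) h', zero_add, add_zero,
          ← ENNReal.ofReal_add (by linarith) hy]
        congr 1; ring
  have hrp : ∫⁻ x, ENNReal.ofReal (r x) ∂ν ≠ ∞ := hint.lintegral_lt_top.ne
  have hrn : ∫⁻ x, ENNReal.ofReal (-r x) ∂ν ≠ ∞ := hint.neg.lintegral_lt_top.ne
  have hFn : ∫⁻ x, (-F x).toENNReal ∂ν ≠ ∞ := ((lintegral_mono hneg).trans_lt hrn.lt_top).ne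
  have hsum := lintegral_congr (μ := ν) key
  rw [lintegral_add_right _ (show Measurable fun x => ENNReal.ofReal (-r x) from
      hr.neg.ennreal_ofReal), lintegral_add_right _ hG,
    lintegral_add_right _ hr.ennreal_ofReal] at hsum
  rw [integral_eq_lintegral_pos_part_sub_lintegral_neg_part hint, eintegral]
  revert hrp hrn hFn hsum
  generalize (∫⁻ x, (F x).toENNReal ∂ν) = A
  generalize (∫⁻ x, (-F x).toENNReal ∂ν) = B
  generalize (∫⁻ x, ENNReal.ofReal (r x) ∂ν) = C
  generalize (∫⁻ x, ENNReal.ofReal (-r x) ∂ν) = D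
  generalize (∫⁻ x, G x ∂ν) = E
  intro hC hD hB hsum
  lift C to ℝ≥0 using hC
  lift D to ℝ≥0 using hD
  lift B to ℝ≥0 using hB
  induction E with
  | top =>
    have hA : A = ⊤ := by
      by_contra hA
      exact ENNReal.add_ne_top.2 ⟨hA, ENNReal.coe_ne_top⟩ (by rw [hsum]; simp)
    rw [hA, EReal.coe_ennreal_top, EReal.top_add_coe]
    exact EReal.top_sub_coe _
  | coe E =>
    have hA : A ≠ ⊤ := by
      intro hA
      rw [hA, top_add] at hsum
      exact ENNReal.add_ne_top.2 ⟨ENNReal.add_ne_top.2 ⟨ENNReal.coe_ne_top, ENNReal.coe_ne_top⟩,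
        ENNReal.coe_ne_top⟩ hsum.symm
    lift A to ℝ≥0 using hA
    have h : (A : ℝ) + D = B + C + E := by exact_mod_cast hsum
    change ((A : ℝ) : EReal) - ((B : ℝ) : EReal) = ((E : ℝ) : EReal) + (((C : ℝ) - D : ℝ) : EReal)
    rw [← EReal.coe_sub, ← EReal.coe_add]
    congr 1
    linarith

theorem HasDensity.lintegral_eq_one {μ P : Measure Ω} {p : Ω → ℝ≥0∞} (h : HasDensity μ P p) :
    ∫⁻ x, p x ∂μ = 1 := by
  have := h.isProbabilityMeasure
  rw [← setLIntegral_univ, ← withDensity_apply _ MeasurableSet.univ, ← h.eq_withDensity,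
    measure_univ]

theorem HasDensity.ae_lt_top {μ P : Measure Ω} {p : Ω → ℝ≥0∞} (h : HasDensity μ P p) :
    ∀ᵐ x ∂μ, p x < ∞ :=
  MeasureTheory.ae_lt_top h.measurable (by simp [h.lintegral_eq_one])

/-- `μ` need not be σ-finite: a measure given by a density has a Lebesgue decomposition anyway, with
vanishing singular part. -/
theorem HasDensity.rnDeriv {μ P : Measure Ω} {p : Ω → ℝ≥0∞} (h : HasDensity μ P p) :
    HasDensity μ P (P.rnDeriv μ) := by
  refine ⟨h.isProbabilityMeasure, Measure.measurable_rnDeriv _ _, ?_⟩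
  have hac : P ≪ μ := h.eq_withDensity ▸ withDensity_absolutelyContinuous μ p
  have : P.HaveLebesgueDecomposition μ := by
    rw [h.eq_withDensity]
    exact Measure.haveLebesgueDecomposition_withDensity μ h.measurable
  conv_lhs => rw [P.haveLebesgueDecomposition_add μ,
    Measure.singularPart_eq_zero_of_ac hac, zero_add]

theorem HasDensity.ae_eq {μ P : Measure Ω} {p p' : Ω → ℝ≥0∞} (h : HasDensity μ P p)
    (h' : HasDensity μ P p') : p =ᵐ[μ] p' := by
  rw [← withDensity_eq_iff h.measurable.aemeasurable h'.measurable.aemeasurable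
    (by simp [h.lintegral_eq_one]), ← h.eq_withDensity, ← h'.eq_withDensity]

theorem HasDensity.eq_of_ae_eq {μ P Q : Measure Ω} {p q : Ω → ℝ≥0∞} (h : HasDensity μ P p)
    (h' : HasDensity μ Q q) (hpq : p =ᵐ[μ] q) : P = Q := by
  rw [h.eq_withDensity, h'.eq_withDensity, withDensity_congr_ae hpq]

/-- The divergence of two distributions in terms of the nonnegative part of a splitting. -/
theorem fDiv_eq_lintegral_persp {μ P Q : Measure Ω} {p q : Ω → ℝ≥0∞} (hP : HasDensity μ P p)
    (hQ : HasDensity μ Q q) {f : ℝ≥0 → EReal} {g : ℝ≥0 → ℝ≥0∞} {m : ℝ≥0∞} {a b : ℝ}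
    (hf : IsSplitting f g m a b) :
    fDiv μ f P Q = ((∫⁻ x, persp g m (p x) (q x) ∂μ : ℝ≥0∞) : EReal) + ((a + b : ℝ) : EReal) := by
  have hcongr : ∫⁻ x, persp g m (p x) (q x) ∂μ
      = ∫⁻ x, persp g m (P.rnDeriv μ x) (Q.rnDeriv μ x) ∂μ := by
    apply lintegral_congr_ae
    filter_upwards [hP.ae_eq hP.rnDeriv, hQ.ae_eq hQ.rnDeriv] with x h1 h2
    rw [h1, h2]
  rw [hcongr]
  replace hP := hP.rnDeriv
  replace hQ := hQ.rnDeriv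
  clear hcongr p q
  unfold fDiv
  set p := P.rnDeriv μ
  set q := Q.rnDeriv μ
  have := hP.isProbabilityMeasure
  have := hQ.isProbabilityMeasure
  have hpm := hP.measurable
  have hqm := hQ.measurable
  have hSm : MeasurableSet {x | 0 < q x} := measurableSet_lt measurable_const hqm
  have hZm : MeasurableSet {x | q x = 0} := hqm (measurableSet_singleton 0)
  have hSc : {x | 0 < q x}ᶜ = {x | q x = 0} := by ext x; simp
  set ν := Q.restrict {x | 0 < q x} with hν
  have hrestr : ∀ G : Ω → ℝ≥0∞, Measurable G →
      ∫⁻ x, G x ∂ν = ∫⁻ x in {x | 0 < q x}, q x * G x ∂μ := by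
    intro G hG
    conv_lhs => rw [hν, hQ.eq_withDensity, restrict_withDensity hSm]
    exact lintegral_withDensity_eq_lintegral_mul _ hqm hG
  have hQ0 : Q {x | q x = 0} = 0 := by
    rw [hQ.eq_withDensity, withDensity_apply _ hZm]
    rw [setLIntegral_congr_fun hZm (g := fun _ => 0) (fun x hx => hx)]
    simp
  have hνu : ν Set.univ = 1 := by
    rw [hν, Measure.restrict_apply_univ]
    have h := measure_add_measure_compl (μ := Q) hSm
    rw [hSc, hQ0, add_zero, measure_univ] at h
    exact h
  have : IsProbabilityMeasure ν := ⟨hνu⟩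
  have hh : Measurable fun x => p x / q x := hpm.div hqm
  have hhint : ∫⁻ x, p x / q x ∂ν = P {x | 0 < q x} := by
    rw [hrestr _ hh, hP.eq_withDensity, withDensity_apply _ hSm]
    apply lintegral_congr_ae
    filter_upwards [ae_restrict_mem hSm, ae_restrict_of_ae hQ.ae_lt_top] with x hx hx'
    exact ENNReal.mul_div_cancel (ne_of_gt hx) hx'.ne
  have hfin : ∫⁻ x, p x / q x ∂ν ≠ ∞ := by rw [hhint]; exact measure_ne_top _ _
  have hi : Integrable (fun x => (p x / q x).toReal) ν :=
    integrable_toReal_of_lintegral_ne_top hh.aemeasurable hfin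
  have hr : Integrable (fun x => a * (p x / q x).toReal + b) ν :=
    (hi.const_mul a).add (integrable_const b)
  have hrint : ∫ x, (a * (p x / q x).toReal + b) ∂ν = a * (P {x | 0 < q x}).toReal + b := by
    rw [integral_add (hi.const_mul a) (integrable_const b), integral_const_mul,
      integral_toReal hh.aemeasurable (MeasureTheory.ae_lt_top hh hfin), hhint]
    simp
  have hGm : Measurable fun x => g (p x / q x).toNNReal :=
    hf.measurable.comp hh.ennreal_toNNReal
  have hE : eintegral ν (fun x => f (p x / q x).toNNReal)
      = ((∫⁻ x, g (p x / q x).toNNReal ∂ν : ℝ≥0∞) : EReal)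
        + ((a * (P {x | 0 < q x}).toReal + b : ℝ) : EReal) := by
    rw [← hrint, ← eintegral_add_real hGm ((hh.ennreal_toReal.const_mul a).add_const b) hr]
    congr 1
    funext x
    exact hf.eq_add _
  have hsplit : ∫⁻ x, persp g m (p x) (q x) ∂μ
      = ∫⁻ x, g (p x / q x).toNNReal ∂ν + m * P {x | q x = 0} := by
    rw [← lintegral_add_compl _ hSm, hSc, hrestr _ hGm]
    congr 1
    · apply setLIntegral_congr_fun hSm
      intro x hx
      exact if_neg (ne_of_gt hx)
    · conv_rhs => rw [hP.eq_withDensity, withDensity_apply _ hZm, ← lintegral_const_mul _ hpm]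
      apply setLIntegral_congr_fun hZm
      intro x hx
      exact if_pos hx
  have hP1 : P {x | 0 < q x} + P {x | q x = 0} = 1 := by
    rw [← hSc, measure_add_measure_compl hSm, measure_univ]
  rw [hE, hsplit, hf.slope_eq]
  have hP1' : (P {x | 0 < q x}).toReal + (P {x | q x = 0}).toReal = 1 := by
    rw [← ENNReal.toReal_add (measure_ne_top _ _) (measure_ne_top _ _), hP1, ENNReal.toReal_one]
  have hz : ((P {x | q x = 0} : ℝ≥0∞) : EReal) = (((P {x | q x = 0}).toReal : ℝ) : EReal) :=
    (EReal.coe_ennreal_toReal (measure_ne_top _ _)).symm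
  rw [EReal.coe_ennreal_add, EReal.coe_ennreal_mul, hz, mul_comm (_ + _) (Real.toEReal _),
    EReal.left_distrib_of_nonneg_of_ne_top (by exact_mod_cast ENNReal.toReal_nonneg)
      (EReal.coe_ne_top _), mul_comm _ (m : EReal), ← EReal.coe_mul, add_add_add_comm,
    ← EReal.coe_add]
  -- The line contributes `a * P[q > 0] + b` through the integral and `a * P[q = 0]` through the
  -- slope, in total `a + b`.
  congr 2
  rw [mul_comm _ a]
  linear_combination a * hP1'

/-! ### Generators of total variation type -/

/-- The generator `|s - s₀| - |1 - s₀|` of a rescaled total variation. -/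
noncomputable def absGenerator (s₀ : ℝ≥0) (s : ℝ≥0) : EReal :=
  ((|(s : ℝ) - s₀| - |1 - (s₀ : ℝ)| : ℝ) : EReal)

theorem isGenerator_absGenerator (s₀ : ℝ≥0) : IsGenerator (absGenerator s₀) where
  ne_bot _ := EReal.coe_ne_bot _
  ne_top _ _ := EReal.coe_ne_top _
  convex s t a b hab := by
    simp only [absGenerator]
    rw [← EReal.coe_mul, ← EReal.coe_mul, ← EReal.coe_add, EReal.coe_le_coe_iff]
    have h1 : (a : ℝ) + b = 1 := by exact_mod_cast hab
    have h2 : ((a * s + b * t : ℝ≥0) : ℝ) - s₀ = a * ((s : ℝ) - s₀) + b * ((t : ℝ) - s₀) := by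
      push_cast; linear_combination (s₀ : ℝ) * h1
    have h3 := abs_add_le (a * ((s : ℝ) - s₀)) (b * ((t : ℝ) - s₀))
    rw [abs_mul, abs_mul, NNReal.abs_eq, NNReal.abs_eq] at h3
    rw [h2]
    linear_combination h3 + |1 - (s₀ : ℝ)| * h1
  map_one := by simp [absGenerator]

theorem isSplitting_absGenerator (s₀ : ℝ≥0) :
    IsSplitting (absGenerator s₀) (fun s => ENNReal.ofReal |(s : ℝ) - s₀|) 1 0
      (-|1 - (s₀ : ℝ)|) := by
  have heq : ∀ s, absGenerator s₀ s = (ENNReal.ofReal |(s : ℝ) - s₀| : EReal)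
      + ((0 * s + -|1 - (s₀ : ℝ)| : ℝ) : EReal) := by
    intro s
    rw [EReal.coe_ennreal_ofReal, max_eq_left (abs_nonneg _), ← EReal.coe_add, absGenerator]
    congr 1; ring
  refine ⟨by fun_prop, heq, slopeAtTop_eq_add heq ?_⟩
  have h1 : Tendsto (fun s : ℝ≥0 => ENNReal.ofReal (1 - s₀ / s)) atTop (nhds 1) := by
    rw [← ENNReal.ofReal_one]
    refine ENNReal.tendsto_ofReal ?_
    have : Tendsto (fun s : ℝ≥0 => (s : ℝ)) atTop atTop := NNReal.tendsto_coe_atTop.2 tendsto_id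
    simpa using (tendsto_const_nhds (x := (1 : ℝ))).sub (this.const_div_atTop (s₀ : ℝ))
  refine h1.congr' ?_
  filter_upwards [eventually_gt_atTop 0, eventually_ge_atTop s₀] with s hs hs'
  have h0 : (0 : ℝ) < s := by exact_mod_cast hs
  have h2 : (s₀ : ℝ) ≤ s := by exact_mod_cast hs'
  rw [abs_of_nonneg (sub_nonneg.2 h2), ← ENNReal.ofReal_coe_nnreal (p := s),
    ← ENNReal.ofReal_div_of_pos h0]
  congr 1
  field_simp

theorem persp_abs (s₀ : ℝ≥0) {u v : ℝ≥0∞} (hu : u < ∞) (hv : v < ∞) :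
    persp (fun s => ENNReal.ofReal |(s : ℝ) - s₀|) 1 u v
      = ENNReal.ofReal |u.toReal - s₀ * v.toReal| := by
  lift u to ℝ≥0 using hu.ne
  lift v to ℝ≥0 using hv.ne
  unfold persp
  rcases eq_or_ne v 0 with rfl | hv0
  · simp
  · have hv' : (v : ℝ) ≠ 0 := by exact_mod_cast hv0
    rw [if_neg (by simpa using hv0), ← ENNReal.coe_div hv0, ENNReal.toNNReal_coe,
      ENNReal.coe_toReal, ENNReal.coe_toReal]
    have e : (u : ℝ) - s₀ * v = v * (((u / v : ℝ≥0) : ℝ) - s₀) := by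
      push_cast
      field_simp
    rw [e, abs_mul, NNReal.abs_eq, ENNReal.ofReal_mul (p := (v : ℝ)) v.2,
      ENNReal.ofReal_coe_nnreal]

/-! ### Clipped densities in the band -/

theorem clip_mem_band {μ : Measure Ω} {qL qU p : Ω → ℝ≥0∞} (hband : IsBand μ qL qU) {c : ℝ≥0}
    {Q : Measure Ω} (hQ : HasDensity μ Q (clip qL qU p c)) : Q ∈ band μ qL qU :=
  ⟨_, hQ, Eventually.of_forall fun x =>
    ⟨le_min (hband.le x) (le_max_right _ _), min_le_left _ _⟩⟩

/-- Two distributions with comparable densities are equal. -/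
theorem HasDensity.eq_of_ae_le {μ P Q : Measure Ω} {p q : Ω → ℝ≥0∞} (hP : HasDensity μ P p)
    (hQ : HasDensity μ Q q) (h : p ≤ᵐ[μ] q) : P = Q :=
  hP.eq_of_ae_eq hQ <| ae_eq_of_ae_le_of_lintegral_le h (by simp [hP.lintegral_eq_one])
    hQ.measurable.aemeasurable (by rw [hP.lintegral_eq_one, hQ.lintegral_eq_one])

/-- Clipping is monotone in the constant, and comparable densities of equal mass agree a.e. -/
theorem clip_unique {μ : Measure Ω} {qL qU p : Ω → ℝ≥0∞} {c c' : ℝ≥0} {Q Q' : Measure Ω}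
    (hQ : HasDensity μ Q (clip qL qU p c)) (hQ' : HasDensity μ Q' (clip qL qU p c')) :
    Q = Q' := by
  have hmono : ∀ {d d' : ℝ≥0}, d ≤ d' → ∀ x, clip qL qU p d x ≤ clip qL qU p d' x := by
    intro d d' h x
    unfold clip
    gcongr
  rcases le_total c c' with h | h
  · exact hQ.eq_of_ae_le hQ' (Eventually.of_forall (hmono h))
  · exact (hQ'.eq_of_ae_le hQ (Eventually.of_forall (hmono h))).symm

/-- If the lower bound is itself a density, the band is a single distribution. -/
theorem eq_of_mem_band_of_clip_zero {μ : Measure Ω} {qL qU p : Ω → ℝ≥0∞} {Q Q' : Measure Ω}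
    (hQ : HasDensity μ Q (clip qL qU p 0)) (hQ' : Q' ∈ band μ qL qU) : Q' = Q := by
  obtain ⟨q, hq, hb⟩ := hQ'
  refine (hQ.eq_of_ae_le hq ?_).symm
  filter_upwards [hb] with x hx
  refine le_trans ?_ hx.1
  simp [clip]

/-- All densities are finite a.e., so monotonicity of `Φ` away from `c * u` is needed at finite
arguments only. -/
theorem ae_persp_le {μ P Q Q' : Measure Ω} {qL qU p q : Ω → ℝ≥0∞} {c : ℝ≥0}
    (hP : HasDensity μ P p) (hQ : HasDensity μ Q (clip qL qU p c)) (hq : HasDensity μ Q' q)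
    (hb : ∀ᵐ x ∂μ, qL x ≤ q x ∧ q x ≤ qU x) {Φ : ℝ≥0∞ → ℝ≥0∞ → ℝ≥0∞}
    (hΦ : ∀ u v w : ℝ≥0, (c * u ≤ v ∧ v ≤ w) ∨ (w ≤ v ∧ v ≤ c * u) → Φ u v ≤ Φ u w) :
    ∀ᵐ x ∂μ, Φ (p x) (clip qL qU p c x) ≤ Φ (p x) (q x) := by
  filter_upwards [hb, hP.ae_lt_top, hQ.ae_lt_top, hq.ae_lt_top] with x hx h1 h2 h3
  have h := clip_between (c := c) (p := p) hx.1 hx.2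
  generalize clip qL qU p c x = v at *
  generalize p x = u at *
  generalize q x = w at *
  lift u to ℝ≥0 using h1.ne
  lift v to ℝ≥0 using h2.ne
  lift w to ℝ≥0 using h3.ne
  exact hΦ u v w (by exact_mod_cast h)

/-- The clipped density is the only minimizer of the total variation distance to `c * p`. -/
theorem eq_of_lintegral_abs_le {μ P Q Q' : Measure Ω} {qL qU p q : Ω → ℝ≥0∞} {c : ℝ≥0}
    (hP : HasDensity μ P p) (hQ : HasDensity μ Q (clip qL qU p c)) (hq : HasDensity μ Q' q)
    (hb : ∀ᵐ x ∂μ, qL x ≤ q x ∧ q x ≤ qU x) {k : ℝ} (hk : 0 < k)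
    (hle : ∫⁻ x, ENNReal.ofReal (k * |c * (p x).toReal - (q x).toReal|) ∂μ
      ≤ ∫⁻ x, ENNReal.ofReal (k * |c * (p x).toReal - (clip qL qU p c x).toReal|) ∂μ) :
    Q' = Q := by
  have habs : ∀ u v w : ℝ≥0, (c * u ≤ v ∧ v ≤ w) ∨ (w ≤ v ∧ v ≤ c * u) →
      |(c : ℝ) * u - v| ≤ |(c : ℝ) * u - w| ∧
        (|(c : ℝ) * u - v| = |(c : ℝ) * u - w| → v = w) := by
    intro u v w h
    have h' : ((c : ℝ) * u ≤ v ∧ (v : ℝ) ≤ w) ∨ ((w : ℝ) ≤ v ∧ (v : ℝ) ≤ c * u) := by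
      exact_mod_cast h
    rw [← NNReal.coe_inj]
    rcases h' with ⟨h1, h2⟩ | ⟨h1, h2⟩
    · rw [abs_of_nonpos (by linarith), abs_of_nonpos (by linarith)]
      exact ⟨by linarith, fun h => by linarith⟩
    · rw [abs_of_nonneg (by linarith), abs_of_nonneg (by linarith)]
      exact ⟨by linarith, fun h => by linarith⟩
  have hpt := ae_persp_le hP hQ hq hb
    (Φ := fun u v => ENNReal.ofReal (k * |c * u.toReal - v.toReal|)) (by
      intro u v w h
      have := (habs u v w h).1
      simp only [ENNReal.coe_toReal]
      gcongr)
  have hqm := hq.measurable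
  have hpm := hP.measurable
  have hcm := hQ.measurable
  -- Finiteness of the smaller integral is what allows equality of the integrals to yield equality
  -- of the integrands a.e.
  have hfin : ∫⁻ x, ENNReal.ofReal (k * |c * (p x).toReal - (clip qL qU p c x).toReal|) ∂μ
      ≠ ∞ := by
    have hb1 : ∀ x, ENNReal.ofReal (k * |c * (p x).toReal - (clip qL qU p c x).toReal|)
        ≤ ENNReal.ofReal k * (c * p x + clip qL qU p c x) := by
      intro x
      rw [ENNReal.ofReal_mul hk.le]
      gcongr
      calc ENNReal.ofReal |c * (p x).toReal - (clip qL qU p c x).toReal|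
          ≤ ENNReal.ofReal (c * (p x).toReal + (clip qL qU p c x).toReal) := by
            apply ENNReal.ofReal_le_ofReal
            have h1 : 0 ≤ (c : ℝ) * (p x).toReal := by positivity
            have h2 : 0 ≤ (clip qL qU p c x).toReal := ENNReal.toReal_nonneg
            rw [abs_le]
            constructor <;> linarith
        _ ≤ c * p x + clip qL qU p c x := by
            rw [ENNReal.ofReal_add (by positivity) ENNReal.toReal_nonneg,
              ENNReal.ofReal_mul (p := (c : ℝ)) c.2, ENNReal.ofReal_coe_nnreal]
            gcongr <;> exact ENNReal.ofReal_toReal_le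
    refine ((lintegral_mono hb1).trans_lt ?_).ne
    rw [lintegral_const_mul _ (by fun_prop), lintegral_add_right _ hcm,
      lintegral_const_mul _ hpm, hP.lintegral_eq_one, hQ.lintegral_eq_one, mul_one]
    exact ENNReal.mul_lt_top ENNReal.ofReal_lt_top (by simp)
  have hae := ae_eq_of_ae_le_of_lintegral_le hpt hfin (by fun_prop) hle
  refine (hQ.eq_of_ae_eq hq ?_).symm
  filter_upwards [hae, hb, hP.ae_lt_top, hQ.ae_lt_top, hq.ae_lt_top] with x he hx h1 h2 h3
  have h := clip_between (c := c) (p := p) hx.1 hx.2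
  generalize clip qL qU p c x = v at *
  generalize p x = u at *
  generalize q x = w at *
  lift u to ℝ≥0 using h1.ne
  lift v to ℝ≥0 using h2.ne
  lift w to ℝ≥0 using h3.ne
  have h' := habs u v w (by exact_mod_cast h)
  simp only [ENNReal.coe_toReal] at he
  rw [ENNReal.ofReal_eq_ofReal_iff (by positivity) (by positivity)] at he
  exact_mod_cast h'.2 (mul_left_cancel₀ hk.ne' he)

/-! ### Minimality and uniqueness -/

theorem isMinOn_fDiv_right {μ P Q : Measure Ω} {qL qU p : Ω → ℝ≥0∞} {c : ℝ≥0} (hc : 0 < c)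
    (hP : HasDensity μ P p) (hQ : HasDensity μ Q (clip qL qU p c)) {f : ℝ≥0 → EReal}
    (hf : IsGenerator f) : IsMinOn (fun Q' => fDiv μ f P Q') (band μ qL qU) Q := by
  rintro Q' ⟨q, hq, hb⟩
  obtain ⟨g, m, a, b, hs, hv⟩ := hf.exists_isSplitting (inv_pos.2 hc)
  change fDiv μ f P Q ≤ fDiv μ f P Q'
  rw [fDiv_eq_lintegral_persp hP hQ hs, fDiv_eq_lintegral_persp hP hq hs]
  gcongr
  exact EReal.coe_ennreal_le_coe_ennreal_iff.2 <| lintegral_mono_ae <|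
    ae_persp_le hP hQ hq hb (Φ := fun u v => persp g m u v)
      fun u v w h => hv.persp_mono_right hc h

theorem isMinOn_fDiv_left {μ P Q : Measure Ω} {qL qU p : Ω → ℝ≥0∞} {c : ℝ≥0} (hc : 0 < c)
    (hP : HasDensity μ P p) (hQ : HasDensity μ Q (clip qL qU p c)) {f : ℝ≥0 → EReal}
    (hf : IsGenerator f) : IsMinOn (fun Q' => fDiv μ f Q' P) (band μ qL qU) Q := by
  rintro Q' ⟨q, hq, hb⟩
  obtain ⟨g, m, a, b, hs, hv⟩ := hf.exists_isSplitting hc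
  change fDiv μ f Q P ≤ fDiv μ f Q' P
  rw [fDiv_eq_lintegral_persp hQ hP hs, fDiv_eq_lintegral_persp hq hP hs]
  gcongr
  exact EReal.coe_ennreal_le_coe_ennreal_iff.2 <| lintegral_mono_ae <|
    ae_persp_le hP hQ hq hb (Φ := fun u v => persp g m v u)
      fun u v w h => hv.persp_mono_left hc h

/-- Since `u - c⁻¹ * v = c⁻¹ * (c * u - v)`, a kink at `c⁻¹` makes the divergence `c⁻¹ * ∫ |c * p -
q| dμ` up to a constant. -/
theorem eq_of_fDiv_right_le {μ P Q Q' : Measure Ω} {qL qU p : Ω → ℝ≥0∞} {c : ℝ≥0}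
    (hc : 0 < c) (hP : HasDensity μ P p) (hQ : HasDensity μ Q (clip qL qU p c))
    (hQ' : Q' ∈ band μ qL qU)
    (hle : fDiv μ (absGenerator c⁻¹) P Q' ≤ fDiv μ (absGenerator c⁻¹) P Q) : Q' = Q := by
  obtain ⟨q, hq, hb⟩ := hQ'
  have hc' : (0 : ℝ) < c := by exact_mod_cast hc
  have hval : ∀ {R : Measure Ω} {r : Ω → ℝ≥0∞}, HasDensity μ R r →
      ∫⁻ x, persp (fun s => ENNReal.ofReal |(s : ℝ) - (c⁻¹ : ℝ≥0)|) 1 (p x) (r x) ∂μ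
        = ∫⁻ x, ENNReal.ofReal ((c : ℝ)⁻¹ * |c * (p x).toReal - (r x).toReal|) ∂μ := by
    intro R r hr
    apply lintegral_congr_ae
    filter_upwards [hP.ae_lt_top, hr.ae_lt_top] with x h1 h2
    rw [persp_abs _ h1 h2]
    congr 1
    have e : (p x).toReal - ((c⁻¹ : ℝ≥0) : ℝ) * (r x).toReal
        = (c : ℝ)⁻¹ * (c * (p x).toReal - (r x).toReal) := by
      push_cast
      field_simp
    rw [e, abs_mul, abs_of_pos (inv_pos.2 hc')]
  rw [fDiv_eq_lintegral_persp hP hQ (isSplitting_absGenerator _),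
    fDiv_eq_lintegral_persp hP hq (isSplitting_absGenerator _),
    (EReal.addLECancellable_coe _).add_le_add_iff_right,
    EReal.coe_ennreal_le_coe_ennreal_iff, hval hQ, hval hq] at hle
  exact eq_of_lintegral_abs_le hP hQ hq hb (inv_pos.2 hc') hle

theorem eq_of_fDiv_left_le {μ P Q Q' : Measure Ω} {qL qU p : Ω → ℝ≥0∞} {c : ℝ≥0}
    (hP : HasDensity μ P p) (hQ : HasDensity μ Q (clip qL qU p c))
    (hQ' : Q' ∈ band μ qL qU)
    (hle : fDiv μ (absGenerator c) Q' P ≤ fDiv μ (absGenerator c) Q P) : Q' = Q := by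
  obtain ⟨q, hq, hb⟩ := hQ'
  have hval : ∀ {R : Measure Ω} {r : Ω → ℝ≥0∞}, HasDensity μ R r →
      ∫⁻ x, persp (fun s => ENNReal.ofReal |(s : ℝ) - c|) 1 (r x) (p x) ∂μ
        = ∫⁻ x, ENNReal.ofReal (1 * |c * (p x).toReal - (r x).toReal|) ∂μ := by
    intro R r hr
    apply lintegral_congr_ae
    filter_upwards [hP.ae_lt_top, hr.ae_lt_top] with x h1 h2
    rw [persp_abs _ h2 h1, one_mul, abs_sub_comm]
  rw [fDiv_eq_lintegral_persp hQ hP (isSplitting_absGenerator _),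
    fDiv_eq_lintegral_persp hq hP (isSplitting_absGenerator _),
    (EReal.addLECancellable_coe _).add_le_add_iff_right,
    EReal.coe_ennreal_le_coe_ennreal_iff, hval hQ, hval hq] at hle
  exact eq_of_lintegral_abs_le hP hQ hq hb one_pos hle

end BandModel

theorem mainTheorem5 {Ω : Type*} [MeasurableSpace Ω] (μ : Measure Ω)
    (qL qU : Ω → ℝ≥0∞) (hband : BandModel.IsBand μ qL qU)
    (P : Measure Ω) (p : Ω → ℝ≥0∞) (hP : BandModel.HasDensity μ P p)
    (c : ℝ≥0) (Qstar : Measure Ω)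
    (hQ : BandModel.HasDensity μ Qstar (BandModel.clip qL qU p c)) :
    -- any distribution of this form, for whatever constant, is the same one
    (∀ (c' : ℝ≥0) (Q : Measure Ω),
        BandModel.HasDensity μ Q (BandModel.clip qL qU p c') → Q = Qstar) ∧
    -- it lies in the band and minimizes both divergences there, for all convex `f`
    Qstar ∈ BandModel.band μ qL qU ∧
    (∀ f : ℝ≥0 → EReal, BandModel.IsGenerator f →
        IsMinOn (fun Q => BandModel.fDiv μ f P Q) (BandModel.band μ qL qU) Qstar ∧
        IsMinOn (fun Q => BandModel.fDiv μ f Q P) (BandModel.band μ qL qU) Qstar) ∧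
    -- it is the only distribution in the band with either of these minimality properties
    (∀ Q ∈ BandModel.band μ qL qU,
        (∀ f : ℝ≥0 → EReal, BandModel.IsGenerator f →
          IsMinOn (fun Q' => BandModel.fDiv μ f P Q') (BandModel.band μ qL qU) Q) →
        Q = Qstar) ∧
    (∀ Q ∈ BandModel.band μ qL qU,
        (∀ f : ℝ≥0 → EReal, BandModel.IsGenerator f →
          IsMinOn (fun Q' => BandModel.fDiv μ f Q' P) (BandModel.band μ qL qU) Q) →
        Q = Qstar) := by
  have hmem := BandModel.clip_mem_band hband hQ
  refine ⟨fun c' Q hQ' => BandModel.clip_unique hQ' hQ, hmem, ?_⟩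
  -- Supporting lines are available only at positive points, so `c = 0` is treated apart.
  rcases eq_or_ne c 0 with rfl | hc
  · refine ⟨fun f _ => ⟨fun Q hQ' => ?_, fun Q hQ' => ?_⟩,
      fun Q hQ' _ => BandModel.eq_of_mem_band_of_clip_zero hQ hQ',
      fun Q hQ' _ => BandModel.eq_of_mem_band_of_clip_zero hQ hQ'⟩ <;>
    · obtain rfl := BandModel.eq_of_mem_band_of_clip_zero hQ hQ'
      exact le_refl (_ : EReal)
  · have hc' : 0 < c := pos_iff_ne_zero.2 hc
    exact ⟨fun f hf => ⟨BandModel.isMinOn_fDiv_right hc' hP hQ hf,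
        BandModel.isMinOn_fDiv_left hc' hP hQ hf⟩,
      fun Q hQ' h => BandModel.eq_of_fDiv_right_le hc' hP hQ hQ'
        (h _ (BandModel.isGenerator_absGenerator _) hmem),
      fun Q hQ' h => BandModel.eq_of_fDiv_left_le hP hQ hQ'
        (h _ (BandModel.isGenerator_absGenerator _) hmem)⟩
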